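/- Let $Q$ be a finite field. A linear systematic $(n,k,r,t)$ PIR code over $Q$ is an injective linear map $\mathcal C\colon Q^k\to Q^n$, $x\mapsto y$, such that $x$ is a sub-vector of $y$ and such that for every $i\in\{1,\dots,k\}$ there are $t$ pairwise disjoint sets $R_1,\dots,R_t\subseteq\{1,\dots,n\}$ with $|R_\ell|\le r$, for each of which $x_i$ is a function of the symbols $(y_j)_{j\in R_\ell}$. Let $\mathcal P_Q(k,r,t)$ be the smallest $n$ for which such a code over $Q$ exists, and let $\mathcal P(k,r,t)$ be the smallest $n$ for which such a code over some finite field exists. Let $k\ge 1$ and $3\le t\le \max\{\lceil k/2\rceil,2\}+2$. Then $$k+t-2+\left\lceil\frac{(t-1)(k-1)+1}{t}\right\rceil\le \mathcal P(k,2,t),$$ and, if $k\ge 3$, $$\mathcal P(k,2,t)\le k+\left\lceil (t-1)\cdot\frac k2\right\rceil .$$ The same bounds hold for $\mathcal P_Q(k,2,t)$, for every finite field $Q$. Moreover, if $t\le k$ (which, for $k\ge3$, excludes only $k=3$, $t=4$), then there is a binary $k\times\lceil (t-1)k/2\rceil$ matrix $A$ with all columns of weight at most $2$, all rows of weight $t-1$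 and no 1-squares (that is, for all rows $i_1\ne i_2$ and columns $j_1\ne j_2$ at least one of the entries $A_{i_1,j_1},A_{i_1,j_2},A_{i_2,j_1},A_{i_2,j_2}$ is zero), such that $[\,I_k\mid A\,]$ generates a binary PIR code with recovery sets of size at most $2$ and query size $t$. -/

import Mathlib

/-- The information symbol `x i` is a function of the coded symbols `C x j`, `j ∈ R`, that is,
`R` is a recovery set for the `i`-th information symbol. -/
def IsRecoverySet {Q ι : Type*} {k : ℕ} (C : (Fin k → Q) → (ι → Q)) (R : Finset ι)
    (i : Fin k) : Prop :=
  ∃ D : (R → Q) → Q, ∀ x : Fin k → Q, D (fun j => C x j) = x i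

/-- The query `(x (q 0), …, x (q (t - 1)))` can be reconstructed from `t` respective pairwise
disjoint recovery sets of size at most `r`. -/
def SupportsQuery {Q ι : Type*} {k t : ℕ} (C : (Fin k → Q) → (ι → Q)) (r : ℕ)
    (q : Fin t → Fin k) : Prop :=
  ∃ R : Fin t → Finset ι,
    (∀ l, (R l).card ≤ r) ∧
    (∀ l l', l ≠ l' → Disjoint (R l) (R l')) ∧
    (∀ l, IsRecoverySet C (R l) (q l))

/-- `C` is a PIR code with recovery sets of size at most `r` and query size `t`:
it is an injective encoding that supports all constant queries `(x i, …, x i)` of size `t`.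
The length of the code is the number of elements of `ι`. -/
def IsPIRCode {Q ι : Type*} {k : ℕ} (C : (Fin k → Q) → (ι → Q)) (r t : ℕ) : Prop :=
  Function.Injective C ∧ ∀ i : Fin k, SupportsQuery C r (fun _ : Fin t => i)

/-- The encoding is systematic: the information vector is a sub-vector of the codeword. -/
def IsSystematic {Q ι : Type*} {k : ℕ} (C : (Fin k → Q) → (ι → Q)) : Prop :=
  ∃ e : Fin k ↪ ι, ∀ (x : Fin k → Q) (i : Fin k), C x (e i) = x i

/-- There is a linear systematic `(n, k, r, t)` PIR code over the field `F`. -/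
def ExistsSystematicPIR (F : Type*) [Field F] (n k r t : ℕ) : Prop :=
  ∃ C : (Fin k → F) →ₗ[F] (Fin n → F), IsSystematic (C : (Fin k → F) → (Fin n → F)) ∧
    IsPIRCode (C : (Fin k → F) → (Fin n → F)) r t

/-- The optimal (shortest) length of a linear systematic PIR code over the fixed field `F`. -/
noncomputable def optimalPIRLengthOver (F : Type*) [Field F] (k r t : ℕ) : ℕ :=
  sInf {n : ℕ | ExistsSystematicPIR F n k r t}

/-- The optimal (shortest) length `P(k, r, t)` of a linear systematic PIR code, over all
finite fields. -/
noncomputable def optimalPIRLength (k r t : ℕ) : ℕ :=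
  sInf {n : ℕ | ∃ (F : Type) (_ : Field F) (_ : Finite F), ExistsSystematicPIR F n k r t}

/-- A matrix has no 1-square: no two distinct rows and two distinct columns meet in four
non-zero entries. -/
def HasNoOneSquare {F : Type*} [Zero F] {k m : ℕ} (A : Matrix (Fin k) (Fin m) F) : Prop :=
  ∀ i₁ i₂ : Fin k, ∀ j₁ j₂ : Fin m, i₁ ≠ i₂ → j₁ ≠ j₂ →
    A i₁ j₁ = 0 ∨ A i₁ j₂ = 0 ∨ A i₂ j₁ = 0 ∨ A i₂ j₂ = 0

/-- The linear encoding `x ↦ x ⬝ [I | A]`. -/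
def systematicEncoding {F : Type*} [Field F] {k m : ℕ} (A : Matrix (Fin k) (Fin m) F) :
    (Fin k → F) → (Fin k ⊕ Fin m → F) :=
  fun x => Matrix.vecMul x (Matrix.fromCols (1 : Matrix (Fin k) (Fin k) F) A)

/-! ### Recovery sets of linear codes -/

/-! View each coordinate as a functional on the message space. If a set `T` of coordinates has rank
`k - 1`, some nonzero message vanishes on `T`; each of the `t` disjoint recovery sets of a nonzero
symbol of it meets its support, so `n ≥ t + |T|` (`add_card_zeros_le_length`). It remains to find a
large `T` (`exists_corank_one_set`). Go in rounds: adjoin a symbol outside the current span, then `s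
= t - 1` disjoint recovery sets of it that avoid its own coordinate. Each recovery set of size at
most two raises the rank by at most one and the nullity (size minus rank) by at least one
(`finrank_span_union_recovery`). A full round thus costs rank at most `t` and gains nullity at least
`t - 1`; the rank rises by steps of at most one, so it cannot skip `k - 1`.

For the upper bound and the binary matrix, take the columns of `A` to be distinct sets of at most
two rows, that is, edges of a simple graph with at most one singleton. If every row has degree `t -
1`, each column through `i` yields a recovery set of `x i`, and these are disjoint because the
columns are distinct. Such a regular family comes from an arbitrary one by degree balancing
(`exists_balanced`) and exists for `t ≤ k`. The remaining case `k = 3`, `t = 4` uses a code of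
length seven. -/

theorem isRecoverySet_iff {F ι : Type*} [Field F] {k : ℕ}
    (C : (Fin k → F) →ₗ[F] (ι → F)) (R : Finset ι) (i : Fin k) :
    IsRecoverySet (C : (Fin k → F) → (ι → F)) R i ↔
      ∀ x : Fin k → F, (∀ j ∈ R, C x j = 0) → x i = 0 := by
  constructor
  · rintro ⟨D, hD⟩ x hx
    have h0 := hD 0
    have hxD := hD x
    have : (fun j : R => C x j) = fun j : R => C 0 j := by
      funext j
      simp [hx j j.2]
    rw [this, h0] at hxD
    simpa using hxD.symm
  · intro h
    -- By linearity, messages whose codewords agree on `R` differ by one vanishing there. The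
    -- decoder is set to `0` on patterns that no codeword attains.
    have hf : Function.FactorsThrough (fun x : Fin k → F => x i)
        (fun x => fun j : R => C x j) := by
      intro x y hxy
      have := h (x - y) fun j hj => by
        have := congrFun hxy ⟨j, hj⟩
        simpa [sub_eq_zero] using this
      simpa [sub_eq_zero] using this
    exact ⟨Function.extend (fun x => fun j : R => C x j) (fun x => x i) 0,
      fun x => hf.extend_apply 0 x⟩

theorem IsSystematic.injective {Q ι : Type*} {k : ℕ} {C : (Fin k → Q) → (ι → Q)}
    (hC : IsSystematic C) : Function.Injective C := by
  obtain ⟨e, he⟩ := hC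
  intro x y hxy
  funext i
  rw [← he x i, ← he y i, hxy]

/-- The length of a code only depends on the number of coordinates. -/
theorem existsSystematicPIR_of_card {F ι : Type*} [Field F] [Fintype ι] {n k r t : ℕ}
    (hn : Fintype.card ι = n) (C : (Fin k → F) →ₗ[F] (ι → F))
    (hs : IsSystematic (C : (Fin k → F) → (ι → F)))
    (hq : ∀ i : Fin k, SupportsQuery (C : (Fin k → F) → (ι → F)) r (fun _ : Fin t => i)) :
    ExistsSystematicPIR F n k r t := by
  classical
  let σ : ι ≃ Fin n := Fintype.equivFinOfCardEq hn
  let C' : (Fin k → F) →ₗ[F] (Fin n → F) :=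
    (LinearEquiv.funCongrLeft F F σ.symm).toLinearMap ∘ₗ C
  have hC' : ∀ x j, C' x j = C x (σ.symm j) := fun x j => rfl
  have hs' : IsSystematic (C' : (Fin k → F) → (Fin n → F)) := by
    obtain ⟨e, he⟩ := hs
    exact ⟨e.trans σ.toEmbedding, fun x i => by simp [hC', he]⟩
  refine ⟨C', hs', hs'.injective, fun i => ?_⟩
  obtain ⟨R, hR, hd, hrec⟩ := hq i
  refine ⟨fun l => (R l).map σ.toEmbedding, fun l => by simpa using hR l,
    fun l l' hl => (Finset.disjoint_map _).2 (hd l l' hl), fun l => ?_⟩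
  rw [isRecoverySet_iff]
  intro x hx
  refine (isRecoverySet_iff C _ _).1 (hrec l) x fun j hj => ?_
  simpa [hC'] using hx (σ j) (by simpa using hj)

/-- The `t`-fold repetition code. -/
theorem existsSystematicPIR_repetition (F : Type*) [Field F] (k : ℕ) {t : ℕ} (ht : 0 < t) :
    ExistsSystematicPIR F (k * t) k 2 t := by
  let C : (Fin k → F) →ₗ[F] (Fin k × Fin t → F) := LinearMap.funLeft F F Prod.fst
  have hC : ∀ x p, C x p = x p.1 := fun x p => rfl
  refine existsSystematicPIR_of_card (ι := Fin k × Fin t) (by simp) C ?_ fun i => ?_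
  · exact ⟨⟨fun i => (i, ⟨0, ht⟩), fun i j h => congrArg Prod.fst h⟩, fun x i => rfl⟩
  · refine ⟨fun l => {(i, l)}, fun l => by simp, fun l l' h => by simpa using h, fun l => ?_⟩
    rw [isRecoverySet_iff]
    intro x hx
    simpa [hC] using hx

/-! ### The lower bound -/

section LowerBound

variable {F V ι : Type*} [Field F] [AddCommGroup V] [Module F V]

theorem finrank_span_image_union_le [FiniteDimensional F V] [DecidableEq ι] (φ : ι → V) (S T : Finset ι) :
    Module.finrank F (Submodule.span F (φ '' (S ∪ T : Finset ι))) ≤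
      Module.finrank F (Submodule.span F (φ '' (S : Set ι))) + T.card := by
  rw [Finset.coe_union, Set.image_union, Submodule.span_union]
  refine (Submodule.finrank_add_le_finrank_add_finrank _ _).trans ?_
  have h : Module.finrank F (Submodule.span F (φ '' (T : Set ι))) ≤ T.card := by
    classical
    rw [← Finset.coe_image]
    exact (finrank_span_finset_le_card _).trans Finset.card_image_le
  omega

/-- If `w` lies in the span of `R` but not in that of `S`, then `R` contains an element outside
`S` that is redundant once `w` is available. -/
theorem exists_redundant [DecidableEq ι] (φ : ι → V) {S R : Finset ι} {w : V}
    (hwR : w ∈ Submodule.span F (φ '' (R : Set ι)))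
    (hwS : w ∉ Submodule.span F (φ '' (S : Set ι))) :
    ∃ j ∈ R, j ∉ S ∧
      φ j ∈ Submodule.span F (insert w (φ '' ((S ∪ R.erase j : Finset ι) : Set ι))) := by
  -- In a minimal `T ⊆ R` that generates `w` together with `S`, any `j ∈ T` is indispensable, so it
  -- can be exchanged with `w`.
  obtain ⟨T, hTR, hT⟩ : ∃ T ⊆ R, Minimal
      (fun T : Finset ι => w ∈ Submodule.span F (φ '' ((S ∪ T : Finset ι) : Set ι))) T := by
    have h : w ∈ Submodule.span F (φ '' ((S ∪ R : Finset ι) : Set ι)) :=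
      Submodule.span_mono (Set.image_mono (by simp)) hwR
    obtain ⟨T, h1, h2⟩ := exists_minimal_le_of_wellFoundedLT
      (fun T : Finset ι => w ∈ Submodule.span F (φ '' ((S ∪ T : Finset ι) : Set ι))) R h
    exact ⟨T, h1, h2⟩
  have hne : T.Nonempty := by
    rw [Finset.nonempty_iff_ne_empty]
    rintro rfl
    exact hwS (by simpa using hT.prop)
  obtain ⟨j, hj⟩ := hne
  have hnot : w ∉ Submodule.span F (φ '' ((S ∪ T.erase j : Finset ι) : Set ι)) :=
    hT.not_prop_of_lt (Finset.erase_ssubset hj)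
  have hins : w ∈ Submodule.span F
      (insert (φ j) (φ '' ((S ∪ T.erase j : Finset ι) : Set ι))) := by
    rw [← Set.image_insert_eq, ← Finset.coe_insert, ← Finset.union_insert,
      Finset.insert_erase hj]
    exact hT.prop
  refine ⟨j, hTR hj, fun hjS => hnot ?_, ?_⟩
  · have : S ∪ T.erase j = S ∪ T := by
      ext a
      by_cases h : a = j <;> simp [h, hjS]
    rw [this]
    exact hT.prop
  · refine Submodule.span_mono (Set.insert_subset_insert (Set.image_mono ?_))
      (mem_span_insert_exchange hins hnot)
    exact_mod_cast Finset.union_subset_union_right (Finset.erase_subset_erase _ hTR)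

/-- Adding a recovery set of size at most two for a symbol `w` that is already available
increases the rank by at most one, and the nullity by at least one. -/
theorem finrank_span_union_recovery [FiniteDimensional F V] [DecidableEq ι] (φ : ι → V) {S S' R : Finset ι} {w : V}
    (hSS' : S ⊆ S') (hR : R.card ≤ 2) (hRS : R ∩ S' ⊆ S)
    (hwR : w ∈ Submodule.span F (φ '' (R : Set ι)))
    (hwS : w ∉ Submodule.span F (φ '' (S : Set ι)))
    (hwS' : w ∈ Submodule.span F (φ '' (S' : Set ι))) :
    Module.finrank F (Submodule.span F (φ '' ((S' ∪ R : Finset ι) : Set ι))) ≤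
        Module.finrank F (Submodule.span F (φ '' (S' : Set ι))) + 1 ∧
      Module.finrank F (Submodule.span F (φ '' ((S' ∪ R : Finset ι) : Set ι))) + S'.card + 1 ≤
        Module.finrank F (Submodule.span F (φ '' (S' : Set ι))) + (S' ∪ R).card := by
  obtain ⟨j, hjR, hjS, hj⟩ := exists_redundant φ hwR hwS
  have hjS' : j ∉ S' := fun h => hjS (hRS (Finset.mem_inter.2 ⟨hjR, h⟩))
  -- As `j` is redundant, only `T`, of at most one element, can add to the rank.
  set T := (R.erase j) \ S' with hT
  have hU : S' ∪ R = insert j (S' ∪ T) := by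
    ext a
    by_cases h : a = j <;> simp [hT, h, hjR]
  have hspan : Submodule.span F (φ '' ((S' ∪ R : Finset ι) : Set ι)) =
      Submodule.span F (φ '' ((S' ∪ T : Finset ι) : Set ι)) := by
    rw [hU, Finset.coe_insert, Set.image_insert_eq, Submodule.span_insert_eq_span]
    refine (Submodule.span_le.2 (Set.insert_subset ?_ ?_)) hj
    · exact Submodule.span_mono (Set.image_mono (by simp)) hwS'
    · refine (Set.image_mono ?_).trans Submodule.subset_span
      rw [Finset.coe_subset, hT, Finset.union_sdiff_self_eq_union]
      exact Finset.union_subset_union_left hSS'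
  have hrank := finrank_span_image_union_le (F := F) φ S' T
  have hTcard : T.card ≤ 1 := by
    have h1 : T.card ≤ (R.erase j).card := Finset.card_le_card Finset.sdiff_subset
    have h2 := Finset.card_erase_of_mem hjR
    omega
  have hcard : (S' ∪ R).card = S'.card + T.card + 1 := by
    rw [hU, Finset.card_insert_of_notMem (by simp [hT, hjS']),
      Finset.card_union_of_disjoint Finset.disjoint_sdiff]
  rw [hspan, hcard]
  constructor <;> omega

/-- The greedy construction of a set of coordinates of corank one and large nullity, started
from a set `S` of nullity at least `(t - 1) / t` times its rank. -/
theorem exists_corank_one_set [FiniteDimensional F V] [Fintype ι] [DecidableEq ι] (φ : ι → V) {k s : ℕ}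
    (e : Fin k → ι)
    (hfull : ∀ S : Finset ι, Module.finrank F (Submodule.span F (φ '' (S : Set ι))) < k →
      ∃ i, φ (e i) ∉ Submodule.span F (φ '' (S : Set ι)))
    (hrec : ∀ i, ∃ R : Fin s → Finset ι, (∀ l, (R l).card ≤ 2) ∧ (∀ l, e i ∉ R l) ∧
      (∀ l l', l ≠ l' → Disjoint (R l) (R l')) ∧
      (∀ l, φ (e i) ∈ Submodule.span F (φ '' (R l : Set ι))))
    (S : Finset ι)
    (hS : Module.finrank F (Submodule.span F (φ '' (S : Set ι))) + 1 ≤ k)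
    (hnull : (s + 1) * Module.finrank F (Submodule.span F (φ '' (S : Set ι))) +
      s * Module.finrank F (Submodule.span F (φ '' (S : Set ι))) ≤ (s + 1) * S.card) :
    ∃ T : Finset ι, Module.finrank F (Submodule.span F (φ '' (T : Set ι))) + 1 = k ∧
      (s + 1) * (k - 1) + s * (k - 2) ≤ (s + 1) * T.card := by
  induction hN : Fintype.card ι - S.card using Nat.strong_induction_on generalizing S with
  | _ N ih =>
  set ρ : Finset ι → ℕ := fun T => Module.finrank F (Submodule.span F (φ '' (T : Set ι))) with hρ
  change ρ S + 1 ≤ k at hS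
  change (s + 1) * ρ S + s * ρ S ≤ (s + 1) * S.card at hnull
  rcases hS.eq_or_lt with hSk | hSk
  · refine ⟨S, hSk, ?_⟩
    obtain rfl : k = ρ S + 1 := hSk.symm
    refine le_trans ?_ hnull
    gcongr <;> omega
  obtain ⟨i, hi⟩ := hfull S (show ρ S < k by omega)
  obtain ⟨R, hR2, hRe, hRd, hRspan⟩ := hrec i
  have heS : e i ∉ S := fun h => hi (Submodule.subset_span (Set.mem_image_of_mem _ h))
  -- If no set of rank `k - 1` is large enough, the round never reaches that rank and can be
  -- completed.
  by_contra hcon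
  push Not at hcon
  -- after adding the symbol and some of its recovery sets, the rank is still small
  have key : ∀ L : Finset (Fin s),
      ρ (insert (e i) S ∪ L.biUnion R) + 1 < k ∧
      ρ (insert (e i) S ∪ L.biUnion R) ≤ ρ S + 1 + L.card ∧
      ρ (insert (e i) S ∪ L.biUnion R) + S.card + L.card ≤
        ρ S + (insert (e i) S ∪ L.biUnion R).card := by
    -- After `c` recovery sets, rank `k - 1` would force `k - 2 ≤ ρ S + c`. The nullity, at least
    -- that of `S` plus `c`, would then be at least `s * (k - 2) / (s + 1)`, contrary to `hcon`.
    have small : ∀ (T : Finset ι) (c : ℕ), ρ T + 1 ≤ k → ρ T ≤ ρ S + 1 + c →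
        ρ T + S.card + c ≤ ρ S + T.card → ρ T + 1 < k := by
      intro T c h1 h2 h3
      refine h1.lt_of_ne fun h => absurd (hcon T h) (not_lt.2 ?_)
      obtain rfl : k = ρ T + 1 := h.symm
      simp only [Nat.add_sub_cancel]
      have h4 : ρ T + 1 - 2 ≤ ρ S + c := by omega
      calc (s + 1) * ρ T + s * (ρ T + 1 - 2) ≤ (s + 1) * ρ T + s * (ρ S + c) := by gcongr
        _ ≤ (s + 1) * T.card := by nlinarith
    intro L
    induction L using Finset.induction_on with
    | empty =>
      have h1 : ρ (insert (e i) S) ≤ ρ S + 1 := by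
        have := finrank_span_image_union_le (F := F) φ S {e i}
        rwa [Finset.card_singleton, Finset.union_comm, ← Finset.insert_eq] at this
      have h2 : (insert (e i) S).card = S.card + 1 := Finset.card_insert_of_notMem heS
      simp only [Finset.biUnion_empty, Finset.union_empty, Finset.card_empty]
      have h3 : ρ (insert (e i) S) + S.card + 0 ≤ ρ S + (insert (e i) S).card := by omega
      exact ⟨small _ 0 (by omega) (by omega) h3, by omega, h3⟩
    | insert l L hl ihL =>
      obtain ⟨g1, g2, g3⟩ := ihL
      set S' := insert (e i) S ∪ L.biUnion R with hS'
      have hSS' : S ⊆ S' :=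
        (Finset.subset_insert _ _).trans Finset.subset_union_left
      have hU : insert (e i) S ∪ (insert l L).biUnion R = S' ∪ R l := by
        rw [Finset.biUnion_insert, Finset.union_comm (R l), ← Finset.union_assoc]
      obtain ⟨g4, g5⟩ := finrank_span_union_recovery (F := F) φ (S := S) (S' := S') (R := R l)
        (w := φ (e i)) hSS' (hR2 l) (by
          intro a ha
          rw [Finset.mem_inter] at ha
          rcases ha with ⟨haR, haS⟩
          rcases Finset.mem_union.1 haS with h | h
          · rcases Finset.mem_insert.1 h with rfl | h
            · exact absurd haR (hRe l)
            · exact h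
          · obtain ⟨l', hl', hal'⟩ := Finset.mem_biUnion.1 h
            have hne : l ≠ l' := by
              rintro rfl
              exact hl hl'
            exact absurd hal' (Finset.disjoint_left.1 (hRd l l' hne) haR))
        (hRspan l) hi
        (Submodule.subset_span (Set.mem_image_of_mem _ (by simp [hS'])))
      change ρ (S' ∪ R l) ≤ ρ S' + 1 at g4
      change ρ (S' ∪ R l) + S'.card + 1 ≤ ρ S' + (S' ∪ R l).card at g5
      rw [hU, Finset.card_insert_of_notMem hl]
      exact ⟨small _ (L.card + 1) (by omega) (by omega) (by omega), by omega, by omega⟩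
  obtain ⟨g1, g2, g3⟩ := key Finset.univ
  set S' := insert (e i) S ∪ Finset.univ.biUnion R with hS'
  rw [Finset.card_univ, Fintype.card_fin] at g2 g3
  have hSS' : S ⊂ S' := by
    refine Finset.ssubset_of_ssubset_of_subset (Finset.ssubset_insert heS)
      Finset.subset_union_left
  have hlt := Finset.card_lt_card hSS'
  have hle := Finset.card_le_univ S'
  -- The full round added rank at most `s + 1` and nullity at least `s`, which preserves the ratio.
  obtain ⟨T, hT1, hT2⟩ := ih (Fintype.card ι - S'.card) (by omega) S' (show ρ S' + 1 ≤ k by omega)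
    (show (s + 1) * ρ S' + s * ρ S' ≤ (s + 1) * S'.card by nlinarith) rfl
  exact absurd (hcon T hT1) (not_lt.2 hT2)

end LowerBound

/-- Every nonzero codeword of a linear PIR code with query size `t` has weight at least `t`. -/
theorem add_card_zeros_le_length {F ι : Type*} [Field F] [Fintype ι] {k r t : ℕ}
    {C : (Fin k → F) →ₗ[F] (ι → F)} {i : Fin k}
    (hq : SupportsQuery (C : (Fin k → F) → (ι → F)) r (fun _ : Fin t => i))
    {T : Finset ι} {x : Fin k → F} (hx : ∀ j ∈ T, C x j = 0) (hxi : x i ≠ 0) :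
    t + T.card ≤ Fintype.card ι := by
  classical
  obtain ⟨R, -, hd, hrec⟩ := hq
  -- A recovery set on which the codeword vanishes would force `x i = 0`.
  have h : ∀ l, ∃ j ∈ R l, C x j ≠ 0 := by
    intro l
    by_contra! h
    exact hxi ((isRecoverySet_iff C _ _).1 (hrec l) x h)
  choose f hfR hf using h
  have hinj : Function.Injective f := by
    intro l l' hll
    by_contra hne
    exact Finset.disjoint_left.1 (hd l l' hne) (hfR l) (hll ▸ hfR l')
  have hdis : Disjoint (Finset.univ.image f) T := by
    rw [Finset.disjoint_left]
    intro j hj hjT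
    obtain ⟨l, -, rfl⟩ := Finset.mem_image.1 hj
    exact hf l (hx _ hjT)
  have := Finset.card_le_univ (Finset.univ.image f ∪ T)
  rwa [Finset.card_union_of_disjoint hdis, Finset.card_image_of_injective _ hinj,
    Finset.card_univ, Fintype.card_fin] at this

theorem length_lower_bound {F : Type*} [Field F] {n k t : ℕ} (hk : 1 ≤ k) (ht : 1 ≤ t)
    (h : ExistsSystematicPIR F n k 2 t) :
    t * (t + (k - 1)) + (t - 1) * (k - 2) ≤ t * n := by
  classical
  obtain ⟨C, ⟨e, he⟩, -, hq⟩ := h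
  obtain ⟨s, rfl⟩ : ∃ s, t = s + 1 := ⟨t - 1, by omega⟩
  let φ : Fin n → Module.Dual F (Fin k → F) := fun j => LinearMap.proj j ∘ₗ C
  have hφe : ∀ i, φ (e i) = LinearMap.proj i := fun i => LinearMap.ext fun x => he x i
  have hker : ∀ (T : Finset (Fin n)) (i : Fin k),
      (∀ x : Fin k → F, (∀ j ∈ T, C x j = 0) → x i = 0) →
      φ (e i) ∈ Submodule.span F (φ '' (T : Set (Fin n))) := by
    intro T i hT
    have := mem_span_of_iInf_ker_le_ker (L := fun j : T => φ j) (K := φ (e i)) (by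
      intro x hx
      rw [Submodule.mem_iInf] at hx
      rw [LinearMap.mem_ker, hφe]
      exact hT x fun j hj => LinearMap.mem_ker.1 (hx ⟨j, hj⟩))
    convert this using 2
    ext y
    simp
  have hfull : ∀ S : Finset (Fin n),
      Module.finrank F (Submodule.span F (φ '' (S : Set (Fin n)))) < k →
      ∃ i, φ (e i) ∉ Submodule.span F (φ '' (S : Set (Fin n))) := by
    intro S hS
    by_contra! hall
    have htop : Submodule.span F (φ '' (S : Set (Fin n))) = ⊤ := by
      rw [eq_top_iff]
      intro f _
      have hf : f = ∑ i, f (Pi.single i 1) • φ (e i) := by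
        refine LinearMap.pi_ext' fun i => LinearMap.ext_ring ?_
        simp [hφe, Pi.single_apply]
      rw [hf]
      exact Submodule.sum_mem _ fun i _ => Submodule.smul_mem _ _ (hall i)
    rw [htop, finrank_top, Subspace.dual_finrank_eq, Module.finrank_fin_fun] at hS
    exact lt_irrefl _ hS
  have hrec : ∀ i, ∃ R : Fin s → Finset (Fin n), (∀ l, (R l).card ≤ 2) ∧ (∀ l, e i ∉ R l) ∧
      (∀ l l', l ≠ l' → Disjoint (R l) (R l')) ∧
      (∀ l, φ (e i) ∈ Submodule.span F (φ '' (R l : Set (Fin n)))) := by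
    intro i
    obtain ⟨R, hR2, hRd, hR⟩ := hq i
    -- By disjointness at most one recovery set contains `e i`; dropping it, or an arbitrary one if
    -- there is none, leaves `s` of them.
    obtain ⟨l₀, hl₀⟩ : ∃ l₀, ∀ l, l ≠ l₀ → e i ∉ R l := by
      by_cases hex : ∃ l₀, e i ∈ R l₀
      · obtain ⟨l₀, hl₀⟩ := hex
        exact ⟨l₀, fun l hl => Finset.disjoint_right.1 (hRd l l₀ hl) hl₀⟩
      · exact ⟨0, fun l _ h => hex ⟨l, h⟩⟩
    refine ⟨fun l => R (l₀.succAbove l), fun l => hR2 _, fun l => hl₀ _ (Fin.succAbove_ne _ _),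
      fun l l' hl => hRd _ _ (Fin.succAbove_right_injective.ne hl), fun l => ?_⟩
    exact hker _ _ ((isRecoverySet_iff C _ _).1 (hR _))
  obtain ⟨T, hT1, hT2⟩ := exists_corank_one_set (F := F) φ e hfull hrec ∅
    (by rw [Finset.coe_empty, Set.image_empty, Submodule.span_empty, finrank_bot]; omega)
    (by rw [Finset.coe_empty, Set.image_empty, Submodule.span_empty, finrank_bot]; simp)
  obtain ⟨i, hi⟩ := hfull T (by omega)
  obtain ⟨x, hx, hxi⟩ : ∃ x : Fin k → F, (∀ j ∈ T, C x j = 0) ∧ x i ≠ 0 := by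
    by_contra! hcon
    exact hi (hker T i hcon)
  have hn := add_card_zeros_le_length (hq i) hx hxi
  rw [Fintype.card_fin] at hn
  calc (s + 1) * (s + 1 + (k - 1)) + (s + 1 - 1) * (k - 2)
      = (s + 1) * (s + 1) + ((s + 1) * (k - 1) + s * (k - 2)) := by
        rw [Nat.add_sub_cancel]; ring
    _ ≤ (s + 1) * (s + 1) + (s + 1) * T.card := by gcongr
    _ = (s + 1) * (s + 1 + T.card) := by ring
    _ ≤ (s + 1) * n := by gcongr
/-! ### Balanced families of sets -/

section Balanced

variable {α : Type*} [DecidableEq α]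

/-- The number of members of `𝒜` that contain `a`. -/
def familyDegree (𝒜 : Finset (Finset α)) (a : α) : ℕ := (𝒜.filter (a ∈ ·)).card

theorem sum_familyDegree  [Fintype α] (𝒜 : Finset (Finset α)) :
    ∑ a, familyDegree 𝒜 a = ∑ A ∈ 𝒜, A.card := by
  simp only [familyDegree, Finset.card_filter]
  rw [Finset.sum_comm]
  simp

/-- A member containing `u` but not `v` may be shifted out of the family if the degree of `u`
exceeds that of `v`. -/
theorem exists_shift {𝒜 : Finset (Finset α)} {u v : α}
    (h : familyDegree 𝒜 v < familyDegree 𝒜 u) :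
    ∃ A ∈ 𝒜, u ∈ A ∧ v ∉ A ∧ insert v (A.erase u) ∉ 𝒜 := by
  by_contra! hcon
  have hu : familyDegree 𝒜 u = (𝒜.filter fun A => u ∈ A ∧ v ∈ A).card +
      (𝒜.filter fun A => u ∈ A ∧ v ∉ A).card := by
    rw [familyDegree, ← Finset.card_filter_add_card_filter_not (fun A : Finset α => v ∈ A),
      Finset.filter_filter, Finset.filter_filter]
  have hv : familyDegree 𝒜 v = (𝒜.filter fun A => u ∈ A ∧ v ∈ A).card +
      (𝒜.filter fun A => v ∈ A ∧ u ∉ A).card := by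
    rw [familyDegree, ← Finset.card_filter_add_card_filter_not (fun A : Finset α => u ∈ A),
      Finset.filter_filter, Finset.filter_filter]
    simp only [and_comm]
  have huv : u ≠ v := by
    rintro rfl
    exact lt_irrefl _ h
  -- Were every shift already in the family, replacing `u` by `v` would be an injection between
  -- these two classes.
  have hle : (𝒜.filter fun A => u ∈ A ∧ v ∉ A).card ≤
      (𝒜.filter fun A => v ∈ A ∧ u ∉ A).card := by
    refine Finset.card_le_card_of_injOn (fun A => insert v (A.erase u)) ?_ ?_
    · intro A hA
      simp only [Finset.coe_filter, Set.mem_ofPred_eq] at hA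
      simp only [Finset.coe_filter, Set.mem_ofPred_eq]
      exact ⟨hcon A hA.1 hA.2.1 hA.2.2, by simp, by simp [huv]⟩
    · intro A hA B hB hAB
      simp only [Finset.coe_filter, Set.mem_ofPred_eq] at hA hB
      have h1 := congrArg (fun X : Finset α => insert u (X.erase v)) hAB
      simpa [Finset.erase_insert, hA.2, hB.2, Finset.insert_erase] using h1
  omega

/-- The shift moves one unit of degree from `u` to `v`; the additive form avoids truncated
subtraction. -/
theorem familyDegree_shift {𝒜 : Finset (Finset α)} {u v : α} {A : Finset α} (hA : A ∈ 𝒜)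
    (huA : u ∈ A) (hvA : v ∉ A) (hB : insert v (A.erase u) ∉ 𝒜) (a : α) :
    familyDegree (insert (insert v (A.erase u)) (𝒜.erase A)) a + (if a = u then 1 else 0) =
      familyDegree 𝒜 a + (if a = v then 1 else 0) := by
  have huv : u ≠ v := by
    rintro rfl
    exact hvA huA
  have h1 : ∀ (ℬ : Finset (Finset α)) (B : Finset α), B ∉ ℬ →
      familyDegree (insert B ℬ) a = familyDegree ℬ a + if a ∈ B then 1 else 0 := by
    intro ℬ B hB
    simp only [familyDegree, Finset.card_filter]
    rw [Finset.sum_insert hB, add_comm]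
  have h2 := h1 (𝒜.erase A) A (Finset.notMem_erase _ _)
  rw [Finset.insert_erase hA] at h2
  rw [h1 _ _ fun h => hB (Finset.mem_of_mem_erase h), h2]
  by_cases hau : a = u
  · subst hau
    simp [huA, huv]
  · by_cases hav : a = v
    · subst hav
      simp [hvA, hau]
    · simp [hau, hav]

/-- A family of sets may be balanced without changing the sizes of its members. -/
theorem exists_balanced  [Fintype α] (p : ℕ → Prop) (m d : ℕ) (𝒜 : Finset (Finset α))
    (hm : 𝒜.card = m) (hp : ∀ A ∈ 𝒜, p A.card)
    (hsum : ∑ A ∈ 𝒜, A.card = d * Fintype.card α) :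
    ∃ ℬ : Finset (Finset α), ℬ.card = m ∧ (∀ A ∈ ℬ, p A.card) ∧
      ∀ a, familyDegree ℬ a = d := by
  -- The potential is the sum of squared degrees. A shift from `u` to `v` with degrees `> d` and `<
  -- d`, hence at least two apart, strictly lowers it.
  induction hN : ∑ a, familyDegree 𝒜 a ^ 2 using Nat.strong_induction_on generalizing 𝒜 with
  | _ N ih =>
  have hdeg : ∑ a, familyDegree 𝒜 a = ∑ _a : α, d := by
    rw [sum_familyDegree, hsum]
    simp [mul_comm]
  by_cases hall : ∀ a, familyDegree 𝒜 a = d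
  · exact ⟨𝒜, hm, hp, hall⟩
  obtain ⟨u, hu⟩ : ∃ u, d < familyDegree 𝒜 u := by
    by_contra! hle
    exact hall fun a => (Finset.sum_eq_sum_iff_of_le fun a _ => hle a).1 hdeg a (Finset.mem_univ a)
  obtain ⟨v, hv⟩ : ∃ v, familyDegree 𝒜 v < d := by
    by_contra! hle
    exact hall fun a =>
      ((Finset.sum_eq_sum_iff_of_le fun a _ => hle a).1 hdeg.symm a (Finset.mem_univ a)).symm
  obtain ⟨A, hA, huA, hvA, hB⟩ := exists_shift (hv.trans hu)
  have hshift := familyDegree_shift hA huA hvA hB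
  have hcardB : (insert v (A.erase u)).card = A.card := by
    rw [Finset.card_insert_of_notMem (by simp [hvA]), Finset.card_erase_add_one huA]
  have hBe : insert v (A.erase u) ∉ 𝒜.erase A := fun h => hB (Finset.mem_of_mem_erase h)
  refine ih _ ?_ (insert (insert v (A.erase u)) (𝒜.erase A)) ?_ ?_ ?_ rfl
  · have huv : u ≠ v := by
      rintro rfl
      exact hvA huA
    have hvu : v ∈ (Finset.univ : Finset α).erase u := by simp [huv.symm]
    rw [← hN, ← Finset.add_sum_erase _ _ (Finset.mem_univ u), ← Finset.add_sum_erase _ _ hvu,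
      ← Finset.add_sum_erase _ (fun a => familyDegree 𝒜 a ^ 2) (Finset.mem_univ u),
      ← Finset.add_sum_erase _ (fun a => familyDegree 𝒜 a ^ 2) hvu]
    have hrest : ∀ a ∈ ((Finset.univ : Finset α).erase u).erase v,
        familyDegree (insert (insert v (A.erase u)) (𝒜.erase A)) a ^ 2 =
          familyDegree 𝒜 a ^ 2 := by
      intro a ha
      simp only [Finset.mem_erase] at ha
      have := hshift a
      simp only [ha.1, ha.2.1, if_false, add_zero] at this
      rw [this]
    rw [Finset.sum_congr rfl hrest]
    have h1 := hshift u
    have h2 := hshift v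
    simp only [huv, huv.symm, if_true, if_false, add_zero] at h1 h2
    rw [h2]
    nlinarith
  · rw [Finset.card_insert_of_notMem hBe, Finset.card_erase_add_one hA, hm]
  · intro X hX
    rcases Finset.mem_insert.1 hX with rfl | hX
    · rw [hcardB]
      exact hp A hA
    · exact hp X (Finset.mem_of_mem_erase hX)
  · rw [Finset.sum_insert hBe, hcardB, Finset.add_sum_erase _ _ hA, hsum]

/-- A near-regular simple graph, with a loop-like singleton if the degree sum is odd. -/
theorem exists_regular_family  [Fintype α] (d : ℕ) (hd : d + 1 ≤ Fintype.card α) :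
    ∃ ℬ : Finset (Finset α), ℬ.card = (d * Fintype.card α + 1) / 2 ∧ (∀ A ∈ ℬ, A.card ≤ 2) ∧
      ∀ a, familyDegree ℬ a = d := by
  obtain ⟨K, hK⟩ : ∃ K, Fintype.card α = K := ⟨_, rfl⟩
  rw [hK] at hd ⊢
  -- The complete graph has `K * (K - 1) / 2` edges and `d ≤ K - 1`. Any choice of edges will do, as
  -- balancing follows.
  have hchoose : d * K / 2 ≤ ((Finset.univ : Finset α).powersetCard 2).card := by
    rw [Finset.card_powersetCard, Finset.card_univ, Nat.choose_two_right, hK]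
    refine Nat.div_le_div_right ?_
    rw [mul_comm]
    exact Nat.mul_le_mul_left _ (by omega)
  obtain ⟨𝒢, hsub, hcard⟩ := Finset.exists_subset_card_eq hchoose
  have h2 : ∀ A ∈ 𝒢, A.card = 2 := fun A hA => (Finset.mem_powersetCard.1 (hsub hA)).2
  have hsum : ∑ A ∈ 𝒢, A.card = d * K / 2 * 2 := by
    rw [Finset.sum_congr rfl h2, Finset.sum_const, hcard, smul_eq_mul]
  rcases Nat.even_or_odd (d * K) with he | ho
  · have := Nat.even_iff.1 he
    exact exists_balanced (· ≤ 2) _ d 𝒢 (by omega) (fun A hA => (h2 A hA).le)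
      (by rw [hsum, hK]; omega)
  -- The singleton supplies the one missing unit of the degree sum.
  · have := Nat.odd_iff.1 ho
    have hpos : 0 < Fintype.card α := by omega
    obtain ⟨a⟩ := Fintype.card_pos_iff.1 hpos
    have hna : ({a} : Finset α) ∉ 𝒢 := fun h => by simpa using h2 _ h
    refine exists_balanced (· ≤ 2) _ d (insert {a} 𝒢) ?_ ?_ ?_
    · rw [Finset.card_insert_of_notMem hna]
      omega
    · intro A hA
      rcases Finset.mem_insert.1 hA with rfl | hA
      · simp
      · exact (h2 A hA).le
    · rw [Finset.sum_insert hna, Finset.card_singleton, hsum, hK]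
      omega

end Balanced

/-! ### Codes from incidence matrices -/

/-- The incidence matrix of a sequence of sets. -/
def incidenceMatrix (F : Type*) [Field F] {k m : ℕ} (f : Fin m → Finset (Fin k)) :
    Matrix (Fin k) (Fin m) F :=
  Matrix.of fun i j => if i ∈ f j then 1 else 0

theorem incidenceMatrix_ne_zero_iff (F : Type*) [Field F] {k m : ℕ} (f : Fin m → Finset (Fin k))
    (i : Fin k) (j : Fin m) : incidenceMatrix F f i j ≠ 0 ↔ i ∈ f j := by
  simp [incidenceMatrix]

/-- The linear map underlying `systematicEncoding`. -/
def systematicLinearMap {F : Type*} [Field F] {k m : ℕ} (A : Matrix (Fin k) (Fin m) F) :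
    (Fin k → F) →ₗ[F] (Fin k ⊕ Fin m → F) :=
  Matrix.vecMulLinear (Matrix.fromCols (1 : Matrix (Fin k) (Fin k) F) A)

theorem systematicLinearMap_inl {F : Type*} [Field F] {k m : ℕ} (A : Matrix (Fin k) (Fin m) F)
    (x : Fin k → F) (i : Fin k) : systematicLinearMap A x (Sum.inl i) = x i := by
  simp [systematicLinearMap, Matrix.vecMul_fromCols]

theorem systematicLinearMap_inr {F : Type*} [Field F] {k m : ℕ} (f : Fin m → Finset (Fin k))
    (x : Fin k → F) (j : Fin m) :
    systematicLinearMap (incidenceMatrix F f) x (Sum.inr j) = ∑ i ∈ f j, x i := by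
  simp [systematicLinearMap, incidenceMatrix, Matrix.vecMul, dotProduct]

theorem isSystematic_systematicLinearMap {F : Type*} [Field F] {k m : ℕ}
    (A : Matrix (Fin k) (Fin m) F) :
    IsSystematic (systematicLinearMap A : (Fin k → F) → (Fin k ⊕ Fin m → F)) :=
  ⟨Function.Embedding.inl, systematicLinearMap_inl A⟩

theorem eq_of_two_common {α : Type*} [DecidableEq α] {A B : Finset α} (hA : A.card ≤ 2)
    (hB : B.card ≤ 2) {a b : α} (hab : a ≠ b) (haA : a ∈ A) (hbA : b ∈ A) (haB : a ∈ B)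
    (hbB : b ∈ B) : A = B := by
  have h : ({a, b} : Finset α).card = 2 := Finset.card_pair hab
  have h1 : {a, b} = A :=
    Finset.eq_of_subset_of_card_le (by simp [Finset.insert_subset_iff, haA, hbA]) (by omega)
  have h2 : {a, b} = B :=
    Finset.eq_of_subset_of_card_le (by simp [Finset.insert_subset_iff, haB, hbB]) (by omega)
  rw [← h1, h2]

theorem hasNoOneSquare_incidenceMatrix (F : Type*) [Field F] {k m : ℕ}
    {f : Fin m → Finset (Fin k)} (hf : Function.Injective f) (h2 : ∀ j, (f j).card ≤ 2) :
    HasNoOneSquare (incidenceMatrix F f) := by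
  intro i₁ i₂ j₁ j₂ hi hj
  by_contra! h
  simp only [incidenceMatrix_ne_zero_iff] at h
  exact hj (hf (eq_of_two_common (h2 _) (h2 _) hi h.1 h.2.2.1 h.2.1 h.2.2.2))

/-- Besides `{i}` itself, each column through `i` recovers `x i` once its other symbol, if any, is
subtracted. Two such sets sharing a symbol would come from equal columns. -/
theorem supportsQuery_incidenceMatrix (F : Type*) [Field F] {k m d : ℕ}
    {f : Fin m → Finset (Fin k)} (hf : Function.Injective f) (h2 : ∀ j, (f j).card ≤ 2)
    (i : Fin k) (hd : (Finset.univ.filter fun j => i ∈ f j).card = d) :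
    SupportsQuery (systematicLinearMap (incidenceMatrix F f) : (Fin k → F) → _) 2
      (fun _ : Fin (d + 1) => i) := by
  let σ : Fin d → Fin m := (Finset.univ.filter fun j => i ∈ f j).orderEmbOfFin hd
  have hσinj : Function.Injective σ := (Finset.orderEmbOfFin _ hd).injective
  have hσ : ∀ l, i ∈ f (σ l) := fun l =>
    (Finset.mem_filter.1 (Finset.orderEmbOfFin_mem _ hd l)).2
  let P : Fin d → Finset (Fin k ⊕ Fin m) := fun l => ((f (σ l)).erase i).disjSum {σ l}
  have hP : ∀ l, Disjoint {Sum.inl i} (P l) := fun l => by simp [P]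
  refine ⟨Fin.cons {Sum.inl i} P, ?_, ?_, ?_⟩
  · refine Fin.cases (by simp) fun l => ?_
    have h1 := Finset.card_erase_of_mem (hσ l)
    have h3 := h2 (σ l)
    simp only [Fin.cons_succ, P, Finset.card_disjSum, Finset.card_singleton]
    omega
  · refine Fin.cases (Fin.cases (fun h => absurd rfl h) fun l' _ => ?_)
      fun l => Fin.cases (fun _ => ?_) fun l' hl => ?_
    · simpa using hP l'
    · simpa using (hP l).symm
    · have hl' : σ l ≠ σ l' := hσinj.ne fun h => hl (congrArg Fin.succ h)
      rw [Fin.cons_succ, Fin.cons_succ, Finset.disjoint_left]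
      rintro (a | j) h1 h3
      · simp only [P, Finset.inl_mem_disjSum, Finset.mem_erase] at h1 h3
        exact hl' (hf (eq_of_two_common (h2 _) (h2 _) h1.1 h1.2 (hσ l) h3.2 (hσ l')))
      · simp only [P, Finset.inr_mem_disjSum, Finset.mem_singleton] at h1 h3
        exact hl' (h1.symm.trans h3)
  · intro l
    rw [isRecoverySet_iff]
    intro x
    refine Fin.cases ?_ (fun l => ?_) l
    · simp [systematicLinearMap_inl]
    · intro hx
      have h1 := hx (Sum.inr (σ l)) (by simp [P])
      rw [systematicLinearMap_inr, ← Finset.add_sum_erase _ _ (hσ l), Finset.sum_eq_zero,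
        add_zero] at h1
      · exact h1
      · intro a ha
        have := hx (Sum.inl a) (by simpa [P] using ha)
        rwa [systematicLinearMap_inl] at this

theorem exists_regular_incidence {k d : ℕ} (hd : d + 1 ≤ k) :
    ∃ f : Fin ((d * k + 1) / 2) → Finset (Fin k), Function.Injective f ∧
      (∀ j, (f j).card ≤ 2) ∧ ∀ i, (Finset.univ.filter fun j => i ∈ f j).card = d := by
  obtain ⟨ℬ, hcard, h2, hdeg⟩ := exists_regular_family (α := Fin k) d (by simpa using hd)
  rw [Fintype.card_fin] at hcard
  let σ := (Finset.equivFinOfCardEq hcard).symm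
  refine ⟨fun j => σ j, Subtype.val_injective.comp σ.injective, fun j => h2 _ (σ j).2,
    fun i => ?_⟩
  refine Eq.trans ?_ (hdeg i)
  refine Finset.card_bij (fun j _ => (σ j : Finset (Fin k))) ?_ ?_ ?_
  · intro j hj
    simpa using hj
  · intro j _ j' _ h
    exact σ.injective (Subtype.val_injective h)
  · intro A hA
    rw [Finset.mem_filter] at hA
    exact ⟨σ.symm ⟨A, hA.1⟩, by simpa using hA.2, by simp⟩

theorem existsSystematicPIR_of_regular (F : Type*) [Field F] {k d : ℕ} (hd : d + 1 ≤ k) :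
    ExistsSystematicPIR F (k + (d * k + 1) / 2) k 2 (d + 1) := by
  obtain ⟨f, hf, h2, hdeg⟩ := exists_regular_incidence hd
  exact existsSystematicPIR_of_card (by simp) _
    (isSystematic_systematicLinearMap (incidenceMatrix F f))
    fun i => supportsQuery_incidenceMatrix F hf h2 i (hdeg i)

/-- The code of length seven whose columns are the nonzero `0`-`1`-vectors of length three. -/
theorem existsSystematicPIR_seven (F : Type*) [Field F] : ExistsSystematicPIR F 7 3 2 4 := by
  let f : Fin 4 → Finset (Fin 3) := ![{0, 1}, {0, 2}, {1, 2}, {0, 1, 2}]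
  refine existsSystematicPIR_of_card (by simp) _
    (isSystematic_systematicLinearMap (incidenceMatrix F f)) ?_
  let R : Fin 3 → Fin 4 → Finset (Fin 3 ⊕ Fin 4) :=
    ![![{.inl 0}, {.inl 1, .inr 0}, {.inl 2, .inr 1}, {.inr 2, .inr 3}],
      ![{.inl 1}, {.inl 0, .inr 0}, {.inl 2, .inr 2}, {.inr 1, .inr 3}],
      ![{.inl 2}, {.inl 0, .inr 1}, {.inl 1, .inr 2}, {.inr 0, .inr 3}]]
  have h012 : ∀ x : Fin 3 → F, ∑ i ∈ ({0, 1, 2} : Finset (Fin 3)), x i = x 0 + x 1 + x 2 :=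
    fun x => Fin.sum_univ_three x
  intro i
  refine ⟨R i, ?_, ?_, ?_⟩
  · revert i; decide
  · revert i; decide
  · intro l
    rw [isRecoverySet_iff]
    intro x hx
    fin_cases i <;> fin_cases l <;>
      simp [R, f, systematicLinearMap_inl, systematicLinearMap_inr, h012] at hx ⊢ <;> grind

/-! ### The optimal length -/

theorem length_upper_bound (F : Type*) [Field F] {k t : ℕ} (hk : 3 ≤ k) (ht : 3 ≤ t)
    (htk : (t : ℤ) ≤ max ⌈(k : ℚ) / 2⌉ 2 + 2) :
    ∃ n ≤ k + ((t - 1) * k + 1) / 2, ExistsSystematicPIR F n k 2 t := by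
  by_cases h : t ≤ k
  · refine ⟨_, le_rfl, ?_⟩
    have := existsSystematicPIR_of_regular F (k := k) (d := t - 1) (by omega)
    rwa [Nat.sub_add_cancel (by omega)] at this
  · have hceil : ⌈(k : ℚ) / 2⌉ ≤ ((k : ℤ) + 1) / 2 := by
      rw [Int.ceil_le, div_le_iff₀ two_pos]
      have : (k : ℤ) ≤ ((k : ℤ) + 1) / 2 * 2 := by omega
      exact_mod_cast this
    -- Here `k < t ≤ max ((k + 1) / 2) 2 + 2` leaves a single case, where length `7` is below the
    -- allowed `8`.
    obtain ⟨rfl, rfl⟩ : k = 3 ∧ t = 4 := by omega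
    exact ⟨7, by norm_num, existsSystematicPIR_seven F⟩

theorem ceil_half_eq (a : ℕ) : ⌈(a : ℚ) / 2⌉ = ((a + 1) / 2 : ℕ) := by
  rw [Int.ceil_eq_iff, Int.cast_natCast, lt_div_iff₀ two_pos, div_le_iff₀ two_pos]
  have h1 : 2 * ((a + 1) / 2) ≤ a + 1 := by omega
  have h2 : a ≤ 2 * ((a + 1) / 2) := by omega
  have h1' : 2 * (((a + 1) / 2 : ℕ) : ℚ) ≤ a + 1 := by exact_mod_cast h1
  have h2' : (a : ℚ) ≤ 2 * (((a + 1) / 2 : ℕ) : ℚ) := by exact_mod_cast h2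
  constructor <;> linarith

theorem ceil_redundancy_eq (k : ℕ) {t : ℕ} (ht : 1 ≤ t) :
    ⌈((t : ℚ) - 1) * k / 2⌉ = (((t - 1) * k + 1) / 2 : ℕ) := by
  rw [← ceil_half_eq]
  push_cast [Nat.cast_sub ht]
  rfl

theorem ceil_lower_bound {F : Type*} [Field F] {n k t : ℕ} (hk : 1 ≤ k) (ht : 1 ≤ t)
    (h : ExistsSystematicPIR F n k 2 t) :
    (k : ℤ) + t - 2 + ⌈(((t : ℚ) - 1) * ((k : ℚ) - 1) + 1) / t⌉ ≤ n := by
  have hb := length_lower_bound hk ht h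
  have hceil : ⌈(((t : ℚ) - 1) * ((k : ℚ) - 1) + 1) / t⌉ ≤ (n : ℤ) - (k + t - 2) := by
    rw [Int.ceil_le, div_le_iff₀ (by exact_mod_cast ht)]
    have hb' : (t : ℤ) * (t + (k - 1)) + (t - 1) * (k - 2) ≤ t * n := by
      -- Only an inequality: at `k = 1` the integer `k - 2` is `-1` but the truncated one is `0`.
      have h1 : ((t : ℤ) - 1) * (k - 2) ≤ ((t - 1 : ℕ) : ℤ) * ((k - 2 : ℕ) : ℤ) := by
        rw [Nat.cast_sub ht, Nat.cast_one]
        exact mul_le_mul_of_nonneg_left (by omega) (by omega)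
      have h2 : ((k - 1 : ℕ) : ℤ) = (k : ℤ) - 1 := by omega
      zify at hb
      rw [← h2]
      linarith
    have hb'' : ((t : ℤ) - 1) * (k - 1) + 1 ≤ ((n : ℤ) - (k + t - 2)) * t := by linarith
    exact_mod_cast hb''
  linarith

theorem mainTheorem3 (k t : ℕ) (hk : 1 ≤ k) (ht : 3 ≤ t)
    (htk : (t : ℤ) ≤ max ⌈(k : ℚ) / 2⌉ 2 + 2) :
    -- the bounds for the optimal length over all finite fields
    ((k : ℤ) + t - 2 + ⌈(((t : ℚ) - 1) * ((k : ℚ) - 1) + 1) / t⌉ ≤ (optimalPIRLength k 2 t : ℤ) ∧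
      (3 ≤ k → (optimalPIRLength k 2 t : ℤ) ≤ (k : ℤ) + ⌈((t : ℚ) - 1) * k / 2⌉)) ∧
    -- the same bounds over each fixed finite field
    (∀ (F : Type*) [Field F] [Finite F],
      (k : ℤ) + t - 2 + ⌈(((t : ℚ) - 1) * ((k : ℚ) - 1) + 1) / t⌉
          ≤ (optimalPIRLengthOver F k 2 t : ℤ) ∧
      (3 ≤ k → (optimalPIRLengthOver F k 2 t : ℤ) ≤ (k : ℤ) + ⌈((t : ℚ) - 1) * k / 2⌉)) ∧
    -- a binary code `[I | A]` whose length is the upper bound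
    (t ≤ k → ∃ (m : ℕ) (A : Matrix (Fin k) (Fin m) (ZMod 2)),
      (m : ℤ) = ⌈((t : ℚ) - 1) * k / 2⌉ ∧
      (∀ j : Fin m, (Finset.univ.filter (fun i : Fin k => A i j ≠ 0)).card ≤ 2) ∧
      (∀ i : Fin k, (Finset.univ.filter (fun j : Fin m => A i j ≠ 0)).card = t - 1) ∧
      HasNoOneSquare A ∧
      IsPIRCode (systematicEncoding A) 2 t) := by
  have ht1 : 1 ≤ t := by omega
  have hup := ceil_redundancy_eq k ht1
  refine ⟨⟨?_, fun hk3 => ?_⟩, fun F _ _ => ⟨?_, fun hk3 => ?_⟩, fun htk' => ?_⟩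
  -- Since `sInf ∅ = 0`, the lower bound needs some code to exist; repetition provides one.
  · have hne : {n : ℕ | ∃ (F : Type) (_ : Field F) (_ : Finite F),
        ExistsSystematicPIR F n k 2 t}.Nonempty :=
      ⟨k * t, ZMod 2, inferInstance, inferInstance,
        existsSystematicPIR_repetition (ZMod 2) k ht1⟩
    obtain ⟨F, _, _, hF⟩ := Nat.sInf_mem hne
    exact ceil_lower_bound hk ht1 hF
  · obtain ⟨n, hn, h⟩ := length_upper_bound (ZMod 2) hk3 ht htk
    have hle : optimalPIRLength k 2 t ≤ n :=
      Nat.sInf_le ⟨ZMod 2, inferInstance, inferInstance, h⟩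
    rw [hup]
    exact_mod_cast hle.trans hn
  · have hne : {n : ℕ | ExistsSystematicPIR F n k 2 t}.Nonempty :=
      ⟨k * t, existsSystematicPIR_repetition F k ht1⟩
    exact ceil_lower_bound hk ht1 (Nat.sInf_mem hne)
  · obtain ⟨n, hn, h⟩ := length_upper_bound F hk3 ht htk
    have hle : optimalPIRLengthOver F k 2 t ≤ n := Nat.sInf_le h
    rw [hup]
    exact_mod_cast hle.trans hn
  · obtain ⟨f, hf, h2, hdeg⟩ := exists_regular_incidence (k := k) (d := t - 1) (by omega)
    have hq := fun i => supportsQuery_incidenceMatrix (ZMod 2) hf h2 i (hdeg i)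
    rw [Nat.sub_add_cancel ht1] at hq
    refine ⟨_, incidenceMatrix (ZMod 2) f, hup.symm, fun j => ?_, fun i => ?_,
      hasNoOneSquare_incidenceMatrix _ hf h2,
      (isSystematic_systematicLinearMap (incidenceMatrix (ZMod 2) f)).injective, hq⟩
    · simpa [incidenceMatrix_ne_zero_iff] using h2 j
    · simpa only [incidenceMatrix_ne_zero_iff] using hdeg i
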